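/- **Communication models.** Let $f:\mathcal X\times\mathcal Y\to\{0,1\}$ with $\mathcal X,\mathcal Y$ finite. In a one-way private-coin protocol, Alice, holding $x$, sends Bob one bit string that depends on $x$ and on her uniformly random string, which Bob does not know; Bob, holding $y$, outputs a bit depending on $y$ and the message. It solves $f$ if on every input it errs with probability at most $1/3$; its cost is the maximum length of Alice's message. $R^{\to}(f)$ is the minimum cost of such a protocol solving $f$. In an online Merlin–Arthur (OMA) protocol, Merlin, who knows $(x,y)$, first sends Bob a help string $H(x,y)$; then a uniformly random string $\mathcal R$ is drawn, Alice sends Bob a bit string depending on $x$ and $\mathcal R$, and Bob outputs an element of $\{0,1,\bot\}$ depending on $y$, the help string, Alice's message and $\mathcal R$. It solves $f$ if $f(x,y)=1$ implies that with help $H(x,y)$ Bob outputs $1$ with probability at least $2/3$, and $f(x,y)=0$ implies that for every help string (of any length) Bob outputs $1$ with probability at most $1/3$. Its hcost is the maximum length of $H(x,y)$, its vcost is the maximum length of Alice's message, and its tcost is $\mathrm{hcost}+\mathrm{vcost}$. $\mathrm{MA}^{\to}(f)$ is the minimum tcost of an OMA protocol solving $f$. For a family $f=(f_n)_{n\in\mathbb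 N}$, a family $\Pi=(\Pi_n)$ of OMA protocols, with $\Pi_n$ solving $f_n$ for every $n$, is *non-trivial* if $\mathrm{vcost}(\Pi_n)=o(R^{\to}(f_n))$ as $n\to\infty$. The non-trivial OMA complexity $\widehat{\mathrm{MA}}^{\to}(f)$ is the minimum tcost over all non-trivial families; $\widehat{\mathrm{MA}}^{\to}(f)=\exp(\Omega(g(n)))$ means that non-trivial families exist and that there is a constant $c>0$ such that every non-trivial family $\Pi$ satisfies $\mathrm{tcost}(\Pi_n)\ge e^{c\,g(n)}$ for all sufficiently large $n$. **The function.** In $\textsc{eq-idx}_{p,q}$ Alice holds $x_1,\dots,x_p\in\{0,1\}^q$, and Bob holds $y\in\{0,1\}^q$ and $j\in\{1,\dots,p\}$; the value is $1$ if $y=x_j$ and $0$ otherwise. Let $f_n=\textsc{eq-idx}_{p,q}$ with $p=\lfloor\log_2 n\rfloor$ and $q=\lfloor n/p\rfloor$ (for $n\geq 2$; the finitely many smaller $n$ are irrelevant). **Corollary 2.** For this explicit function $f$, $$\widehat{\mathrm{MA}}^{\to}(f)=\exp\bigl(\Omega(\mathrm{MA}^{\to}(f))\bigr)\qquad\text{and}\qquad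 \widehat{\mathrm{MA}}^{\to}(f)=\exp\bigl(\Omega(R^{\to}(f))\bigr).$$ -/

import Mathlib

open Filter Asymptotics

noncomputable section

/-- Probability of the event `E` when a string of `r` independent fair coins is drawn. -/
def coinProb (r : ℕ) (E : (Fin r → Bool) → Prop) : ℝ :=
  (Nat.card {ω : Fin r → Bool // E ω} : ℝ) / 2 ^ r

/-! ### One-way randomized communication with private coins -/

/-- A one-way protocol with private coins: Alice draws `coins` fair coins, unknown to Bob, and
sends one bit string, a function of her input and the coins; Bob's output bit is a function of
his input and the message. -/
structure OneWayProtocol (X Y : Type) where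
  coins : ℕ
  msg : X → (Fin coins → Bool) → List Bool
  out : Y → List Bool → Bool

namespace OneWayProtocol

variable {X Y : Type}

/-- The protocol errs with probability at most `1/3` on every input. -/
def Solves (P : OneWayProtocol X Y) (f : X → Y → Bool) : Prop :=
  ∀ x y, coinProb P.coins (fun ω => P.out y (P.msg x ω) ≠ f x y) ≤ 1 / 3

/-- Maximum length of Alice's message over all her inputs and coin outcomes. -/
def cost [Fintype X] (P : OneWayProtocol X Y) : ℕ :=
  (Finset.univ : Finset (X × (Fin P.coins → Bool))).sup fun a => (P.msg a.1 a.2).length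

end OneWayProtocol

/-- The one-way (private-coin) randomized communication complexity `R^→(f)`. -/
def oneWayComplexity {X Y : Type} [Fintype X] (f : X → Y → Bool) : ℕ :=
  sInf {c | ∃ P : OneWayProtocol X Y, P.Solves f ∧ P.cost = c}

/-! ### Online Merlin-Arthur communication -/

/-- An online Merlin-Arthur protocol: Merlin, who knows both inputs, sends Bob the help string
`help x y`; afterwards `coins` fair coins are drawn, Alice sends Bob a message, a function of her
input and the coins, and Bob answers `some true` (1), `some false` (0) or `none` (reject), as a
function of his input, the help string, Alice's message and the coins. -/
structure OMAProtocol (X Y : Type) where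
  coins : ℕ
  help : X → Y → List Bool
  msg : X → (Fin coins → Bool) → List Bool
  out : Y → List Bool → List Bool → (Fin coins → Bool) → Option Bool

namespace OMAProtocol

variable {X Y : Type}

/-- Completeness error and soundness error are at most `1/3`. In the soundness condition the
help string is arbitrary, but is fixed before the coins are drawn. -/
def Solves (P : OMAProtocol X Y) (f : X → Y → Bool) : Prop :=
  (∀ x y, f x y = true →
    coinProb P.coins (fun ω => P.out y (P.help x y) (P.msg x ω) ω ≠ some true) ≤ 1 / 3) ∧
  (∀ x y, f x y = false → ∀ h : List Bool,
    coinProb P.coins (fun ω => P.out y h (P.msg x ω) ω = some true) ≤ 1 / 3)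

/-- Help cost: maximum length of Merlin's help string over all inputs. -/
def hcost [Fintype X] [Fintype Y] (P : OMAProtocol X Y) : ℕ :=
  (Finset.univ : Finset (X × Y)).sup fun a => (P.help a.1 a.2).length

/-- Verification cost: maximum length of Alice's message over all inputs and coin outcomes. -/
def vcost [Fintype X] (P : OMAProtocol X Y) : ℕ :=
  (Finset.univ : Finset (X × (Fin P.coins → Bool))).sup fun a => (P.msg a.1 a.2).length

/-- Total cost. -/
def tcost [Fintype X] [Fintype Y] (P : OMAProtocol X Y) : ℕ := P.hcost + P.vcost

end OMAProtocol

/-- The online Merlin-Arthur complexity `MA^→(f)`. -/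
def omaComplexity {X Y : Type} [Fintype X] [Fintype Y] (f : X → Y → Bool) : ℕ :=
  sInf {c | ∃ P : OMAProtocol X Y, P.Solves f ∧ P.tcost = c}

/-! ### Non-trivial OMA complexity

Being non-trivial is an asymptotic property, so it is a property of a family of protocols for a
family of functions. -/

/-- The family `P` of OMA protocols solves the family `f` of functions and is non-trivial: its
verification cost is `o(R^→(f))`. -/
def IsNontrivialOMA {X Y : ℕ → Type} [∀ n, Fintype (X n)]
    (f : ∀ n, X n → Y n → Bool) (P : ∀ n, OMAProtocol (X n) (Y n)) : Prop :=
  (∀ n, (P n).Solves (f n)) ∧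
    (fun n => ((P n).vcost : ℝ)) =o[atTop] fun n => (oneWayComplexity (f n) : ℝ)

/-- The total costs, as functions of `n`, of the non-trivial OMA protocols for `f`: the
non-trivial OMA complexity of `f` is the minimum of this set, in the asymptotic sense. -/
def nontrivialOMACosts {X Y : ℕ → Type} [∀ n, Fintype (X n)] [∀ n, Fintype (Y n)]
    (f : ∀ n, X n → Y n → Bool) : Set (ℕ → ℕ) :=
  {t | ∃ P : ∀ n, OMAProtocol (X n) (Y n), IsNontrivialOMA f P ∧ ∀ n, t n = (P n).tcost}

/-- The non-trivial OMA complexity of `f` is `exp(Ω(g))`: non-trivial protocols exist, and each of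
them has total cost at least `exp(c * g n)` for all large `n`, with one constant `c > 0` for all
of them. -/
def NontrivialOMAIsExpOmega {X Y : ℕ → Type} [∀ n, Fintype (X n)] [∀ n, Fintype (Y n)]
    (f : ∀ n, X n → Y n → Bool) (g : ℕ → ℕ) : Prop :=
  (nontrivialOMACosts f).Nonempty ∧
    ∃ c : ℝ, 0 < c ∧ ∀ t ∈ nontrivialOMACosts f,
      ∀ᶠ n in atTop, Real.exp (c * (g n : ℝ)) ≤ (t n : ℝ)

/-! ### The Equals-Index problem -/

/-- `eq-idx_{p,q}`: Alice holds `x_1, …, x_p ∈ {0,1}^q`, Bob holds `y ∈ {0,1}^q` and `j ∈ [p]`;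
the value is `1` if and only if `y = x_j`. -/
def eqIdx (p q : ℕ) (x : Fin p → Fin q → Bool) (b : (Fin q → Bool) × Fin p) : Bool :=
  decide (b.1 = x b.2)

/-- `eq-idx_{p,q}` with `p = log n` and `q = n / log n`, rounded down (logarithm to base 2). -/
def eqIdxLog (n : ℕ) :
    (Fin (Nat.log 2 n) → Fin (n / Nat.log 2 n) → Bool) →
      (Fin (n / Nat.log 2 n) → Bool) × Fin (Nat.log 2 n) → Bool :=
  eqIdx (Nat.log 2 n) (n / Nat.log 2 n)

end

/-! ### Bit strings and probabilities -/

/-! With p blocks, n is about 2^p and a block has q ≈ n/p bits. The heart is a threshold: by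
`OMAProtocol.eqIdx_vcost_lower_bound`, help shorter than about q/2 forces vcost Ω(p). By pigeonhole,
very many inputs x share the honest help strings for all p yes-instances y = x_j. Among these,
`exists_shattered` finds p/8 blocks at which two words can be chosen independently. With the common
help fixed, Bob's verdict on one of the two words reveals the choice, by completeness in one case
and soundness in the other. Alice's messages thus solve the index problem on p/8 bits with public
coins, and `index_lower_bound` applies.

Fingerprinting gives R = O(p), so vcost o(R) is o(p) and a non-trivial protocol needs help about
q/2, exponential in p. Empty help shows R = Ω(p), which is unbounded, so the protocol with two-bit
messages from `exists_omaProtocol_eqIdx` is non-trivial. Since MA ≤ R, the bound in terms of R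
implies the one in terms of MA. -/

theorem coinProb_eq_card (r : ℕ) (E : (Fin r → Bool) → Prop) [DecidablePred E] :
    coinProb r E = ((Finset.univ.filter E).card : ℝ) / 2 ^ r := by
  rw [coinProb, Nat.card_eq_fintype_card, Fintype.card_subtype]

/-- The finite set of bit strings of length at most `v`. -/
def shortStrings (v : ℕ) : Finset (List Bool) :=
  (Finset.range (v + 1)).biUnion fun k =>
    (Finset.univ : Finset (Fin k → Bool)).image List.ofFn

theorem mem_shortStrings {v : ℕ} {l : List Bool} (h : l.length ≤ v) : l ∈ shortStrings v := by
  simp only [shortStrings, Finset.mem_biUnion, Finset.mem_range, Finset.mem_image,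
    Finset.mem_univ, true_and]
  exact ⟨l.length, by omega, l.get, List.ofFn_get l⟩

theorem card_shortStrings_le (v : ℕ) : (shortStrings v).card ≤ 2 ^ (v + 1) := by
  calc (shortStrings v).card ≤ ∑ k ∈ Finset.range (v + 1),
        ((Finset.univ : Finset (Fin k → Bool)).image List.ofFn).card := Finset.card_biUnion_le
    _ ≤ ∑ k ∈ Finset.range (v + 1), 2 ^ k := by
        refine Finset.sum_le_sum fun k _ => Finset.card_image_le.trans ?_
        simp
    _ ≤ 2 ^ (v + 1) := by
        rw [Nat.geomSum_eq le_rfl]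
        simp

/-- A nonempty type with at most `2 ^ k` elements can be encoded by bit strings of length `k`. -/
theorem exists_fixedLength_code {A : Type*} [Fintype A] [Nonempty A] {k : ℕ}
    (h : Fintype.card A ≤ 2 ^ k) :
    ∃ (enc : A → List Bool) (dec : List Bool → A),
      (∀ a, dec (enc a) = a) ∧ ∀ a, (enc a).length = k := by
  obtain ⟨e⟩ : Nonempty (A ↪ (Fin k → Bool)) :=
    Function.Embedding.nonempty_of_card_le (by simpa using h)
  have hinj : Function.Injective fun a => List.ofFn (e a) :=
    List.ofFn_injective.comp e.injective
  exact ⟨fun a => List.ofFn (e a), Function.invFun fun a => List.ofFn (e a),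
    Function.leftInverse_invFun hinj, fun a => by simp⟩

/-! ### The index problem -/

/-- The weight is a product over coordinates, each contributing 1 + 1/2. For error 1/3 the weight s
= 1/2 maximizes 2·s^(1/3)/(1+s), the base (before cubing) in the index bound. -/
theorem sum_half_pow_dist {d : ℕ} (c : Fin d → Bool) :
    ∑ z : Fin d → Bool, (1 / 2 : ℝ) ^ (Finset.univ.filter fun k => c k ≠ z k).card
      = (3 / 2) ^ d := by
  have h1 : ∀ z : Fin d → Bool, (1 / 2 : ℝ) ^ (Finset.univ.filter fun k => c k ≠ z k).card
      = ∏ k, if c k ≠ z k then (1 / 2 : ℝ) else 1 := fun z => by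
    rw [Finset.prod_ite]
    simp
  have h2 : ∀ k, ∑ b : Bool, (if c k ≠ b then (1 / 2 : ℝ) else 1) = 3 / 2 := fun k => by
    cases c k <;> simp <;> norm_num
  simp_rw [h1]
  have := Finset.prod_univ_sum (fun _ : Fin d => (Finset.univ : Finset Bool))
    (fun k b => if c k ≠ b then (1 / 2 : ℝ) else 1)
  rw [Fintype.piFinset_univ] at this
  rw [← this]
  simp_rw [h2]
  rw [Finset.prod_const, Finset.card_univ, Fintype.card_fin]

/-- One-way lower bound for the index problem, with coins known to both players. -/
theorem index_lower_bound {d r v : ℕ} (msg : (Fin d → Bool) → (Fin r → Bool) → List Bool)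
    (guess : List Bool → (Fin r → Bool) → Fin d → Bool)
    (hlen : ∀ z ω, (msg z ω).length ≤ v)
    (hg : ∀ z k, coinProb r (fun ω => guess (msg z ω) ω k ≠ z k) ≤ 1 / 3) :
    (32 / 27 : ℝ) ^ d ≤ 8 ^ (v + 1) := by
  set D : (Fin d → Bool) → (Fin r → Bool) → ℕ := fun z ω =>
    (Finset.univ.filter fun k => guess (msg z ω) ω k ≠ z k).card with hD
  set μ : ℝ := d * Real.log 2 / 3 with hμ
  -- For fixed coins there are at most 2^(v+1) messages, hence as many guessed words; each has total
  -- weight (3/2)^d.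
  have hupper : ∑ z, ∑ ω, (1 / 2 : ℝ) ^ D z ω ≤ 2 ^ r * (2 ^ (v + 1) * (3 / 2) ^ d) := by
    rw [Finset.sum_comm]
    have : ∀ ω, ∑ z, (1 / 2 : ℝ) ^ D z ω ≤ 2 ^ (v + 1) * (3 / 2) ^ d := fun ω => by
      calc ∑ z, (1 / 2 : ℝ) ^ D z ω
          ≤ ∑ z : Fin d → Bool, ∑ m ∈ shortStrings v,
              (1 / 2 : ℝ) ^ (Finset.univ.filter fun k => guess m ω k ≠ z k).card := by
            refine Finset.sum_le_sum fun z _ => ?_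
            exact Finset.single_le_sum (s := shortStrings v)
              (f := fun m => (1 / 2 : ℝ) ^ (Finset.univ.filter fun k => guess m ω k ≠ z k).card)
              (fun _ _ => by positivity) (mem_shortStrings (hlen z ω))
        _ = (shortStrings v).card * (3 / 2 : ℝ) ^ d := by
            rw [Finset.sum_comm]
            simp_rw [sum_half_pow_dist]
            simp
        _ ≤ 2 ^ (v + 1) * (3 / 2) ^ d := by
            gcongr
            exact_mod_cast card_shortStrings_le v
    refine (Finset.sum_le_sum fun ω _ => this ω).trans ?_
    simp
  have hsum : ∑ z, ∑ ω, (D z ω : ℝ) ≤ 2 ^ d * (d * (2 ^ r / 3)) := by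
    have : ∀ z, ∑ ω, (D z ω : ℝ) ≤ d * (2 ^ r / 3) := fun z => by
      have h1 : ∑ ω, (D z ω : ℝ)
          = ∑ k, ((Finset.univ.filter fun ω => guess (msg z ω) ω k ≠ z k).card : ℝ) := by
        simp only [hD, Finset.card_filter, Nat.cast_sum]
        exact Finset.sum_comm
      rw [h1]
      calc _ ≤ ∑ _k : Fin d, (2 ^ r / 3 : ℝ) := by
            refine Finset.sum_le_sum fun k _ => ?_
            have := hg z k
            rw [coinProb_eq_card, div_le_iff₀ (by positivity)] at this
            linarith
        _ = _ := by simp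
    refine (Finset.sum_le_sum fun z _ => this z).trans ?_
    simp
  have hlower : Real.exp (-μ) * (2 ^ d * 2 ^ r) ≤ ∑ z, ∑ ω, (1 / 2 : ℝ) ^ D z ω := by
    -- Jensen's inequality by hand: the tangent to exp at -μ, where μ is the bound on the mean of
    -- `D` times log 2.
    have hpt : ∀ z ω, Real.exp (-μ) * (1 + μ - D z ω * Real.log 2) ≤ (1 / 2 : ℝ) ^ D z ω :=
      fun z ω => by
        have h1 : (1 / 2 : ℝ) ^ D z ω = Real.exp (-μ) * Real.exp (μ - D z ω * Real.log 2) := by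
          rw [← Real.exp_add, one_div, inv_pow,
            show -μ + (μ - D z ω * Real.log 2) = -(D z ω * Real.log 2) by ring, Real.exp_neg,
            Real.exp_nat_mul, Real.exp_log two_pos]
        rw [h1]
        gcongr
        linarith [Real.add_one_le_exp (μ - D z ω * Real.log 2)]
    refine le_trans ?_ (Finset.sum_le_sum fun z _ => Finset.sum_le_sum fun ω _ => hpt z ω)
    simp_rw [← Finset.mul_sum, Finset.sum_sub_distrib, ← Finset.sum_mul]
    gcongr
    have hlog : 0 ≤ Real.log 2 := Real.log_nonneg (by norm_num)
    have := mul_le_mul_of_nonneg_right hsum hlog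
    simp only [Finset.sum_const, Finset.card_univ, Fintype.card_pi, Fintype.card_bool,
      Finset.prod_const, Fintype.card_fin, nsmul_eq_mul, Nat.cast_pow, Nat.cast_ofNat]
    have h3 : (2 : ℝ) ^ d * (d * (2 ^ r / 3)) * Real.log 2 = 2 ^ d * 2 ^ r * μ := by
      rw [hμ]; ring
    nlinarith
  have hmain : Real.exp (-μ) * 2 ^ d ≤ 2 ^ (v + 1) * (3 / 2) ^ d := by
    have h := hlower.trans hupper
    have h2 : (0 : ℝ) < 2 ^ r := by positivity
    refine le_of_mul_le_mul_left ?_ h2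
    linarith
  -- Cubing removes the exponent d/3; the base becomes 4/(27/8) = 32/27 > 1.
  have hcube := pow_le_pow_left₀ (by positivity) hmain 3
  have hexp : Real.exp (-μ) ^ 3 = (1 / 2) ^ d := by
    rw [← Real.exp_nat_mul, hμ,
      show ((3 : ℕ) : ℝ) * -(d * Real.log 2 / 3) = -(d * Real.log 2) by push_cast; ring,
      Real.exp_neg, Real.exp_nat_mul, Real.exp_log two_pos, one_div, inv_pow]
  have e1 : (Real.exp (-μ) * 2 ^ d) ^ 3 = (32 / 27 : ℝ) ^ d * (27 / 8) ^ d := by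
    rw [mul_pow, hexp, ← pow_mul, mul_comm d 3, pow_mul, ← mul_pow, ← mul_pow]
    norm_num
  have e2 : ((2 : ℝ) ^ (v + 1) * (3 / 2) ^ d) ^ 3 = 8 ^ (v + 1) * (27 / 8) ^ d := by
    rw [mul_pow, ← pow_mul, ← pow_mul, mul_comm _ 3, mul_comm _ 3, pow_mul, pow_mul]
    norm_num
  rw [e1, e2] at hcube
  exact le_of_mul_le_mul_right hcube (by positivity)

/-! ### Shattering -/

/-- A large set of words over a finite alphabet has `d` positions, with two letters at each, such
that every choice between the two letters at these positions is realized by a word of the set. -/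
theorem exists_shattered {A : Type*} [Fintype A] [Nonempty A] {p : ℕ} :
    ∀ (d : ℕ) (S : Finset (Fin p → A)), 2 ^ p * Fintype.card A ^ (2 * d) < S.card →
      ∃ (i : Fin d → Fin p) (a b : Fin d → A), (∀ k, a k ≠ b k) ∧
        ∀ z : Fin d → Bool, ∃ x ∈ S, ∀ k, x (i k) = if z k then b k else a k := by
  classical
  induction p with
  | zero =>
    intro d S hS
    have h1 : S.card ≤ 1 := Finset.card_le_one_of_subsingleton S
    have := Nat.one_le_pow (2 * d) _ (Fintype.card_pos (α := A))
    omega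
  | succ p ih =>
    intro d S hS
    rcases d with _ | d
    · obtain ⟨x, hx⟩ : S.Nonempty := Finset.card_pos.mp (by omega)
      exact ⟨Fin.elim0, Fin.elim0, Fin.elim0, fun k => k.elim0, fun _ => ⟨x, hx, fun k => k.elim0⟩⟩
    set K := Fintype.card A with hK
    set S' : Finset (Fin p → A) := S.image Fin.tail with hS'
    set T : A × A → Finset (Fin p → A) := fun ab =>
      Finset.univ.filter fun x => Fin.cons ab.1 x ∈ S ∧ Fin.cons ab.2 x ∈ S with hT
    set O : Finset (A × A) := Finset.univ.filter fun ab => ab.1 ≠ ab.2 with hO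
    -- If there are many tails, the first letter is not needed. Otherwise many words share their
    -- tail with another word, and the first position can be made free.
    by_cases hlarge : 2 ^ p * K ^ (2 * (d + 1)) < S'.card
    · obtain ⟨i, a, b, hab, hz⟩ := ih (d + 1) S' hlarge
      refine ⟨fun k => (i k).succ, a, b, hab, fun z => ?_⟩
      obtain ⟨x', hx', hk⟩ := hz z
      obtain ⟨x, hx, rfl⟩ := Finset.mem_image.mp hx'
      exact ⟨x, hx, hk⟩
    have hrep : ∀ x : Fin p → A, ∃ c : A, x ∈ S' → (Fin.cons c x : Fin (p + 1) → A) ∈ S := by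
      intro x
      by_cases hx : x ∈ S'
      · obtain ⟨s, hs, rfl⟩ := Finset.mem_image.mp hx
        exact ⟨s 0, fun _ => by rwa [Fin.cons_self_tail]⟩
      · exact ⟨Classical.arbitrary A, fun h => absurd h hx⟩
    choose rep hrep using hrep
    have htail : ∀ s ∈ S, Fin.tail s ∈ S' := fun s hs => Finset.mem_image_of_mem _ hs
    have hext : ∀ s t : Fin (p + 1) → A, s 0 = t 0 → Fin.tail s = Fin.tail t → s = t :=
      fun s t h0 ht => by rw [← Fin.cons_self_tail s, ← Fin.cons_self_tail t, h0, ht]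
    have hc1 : (S.filter fun s => s 0 = rep (Fin.tail s)).card ≤ S'.card := by
      refine Finset.card_le_card_of_injOn Fin.tail
        (fun s hs => htail s (Finset.mem_filter.mp hs).1) fun s hs t ht hst => ?_
      have h1 := (Finset.mem_filter.mp hs).2
      have h2 := (Finset.mem_filter.mp ht).2
      exact hext s t (by rw [h1, h2, hst]) hst
    -- A word whose first letter is not the representative of its tail yields a tail extendable by
    -- two distinct letters.
    have hc2 : (S.filter fun s => ¬ s 0 = rep (Fin.tail s)).card ≤ ∑ ab ∈ O, (T ab).card := by
      rw [← Finset.card_sigma]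
      refine Finset.card_le_card_of_injOn
        (fun s => (⟨(rep (Fin.tail s), s 0), Fin.tail s⟩ : Σ _ : A × A, Fin p → A))
        (fun s hs => ?_) fun s hs t ht hst => ?_
      · obtain ⟨h1, h2⟩ := Finset.mem_filter.mp hs
        simp only [Finset.coe_sigma, Set.mem_sigma_iff, Finset.mem_coe, hO, hT,
          Finset.mem_filter, Finset.mem_univ, true_and, Fin.cons_self_tail]
        exact ⟨fun h => h2 h.symm, hrep _ (htail s h1), h1⟩
      · simp only [Sigma.mk.injEq, Prod.mk.injEq, heq_eq_eq] at hst
        exact hext s t hst.1.2 hst.2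
    have hcard : S.card ≤ S'.card + ∑ ab ∈ O, (T ab).card := by
      rw [← Finset.card_filter_add_card_filter_not (s := S) fun s => s 0 = rep (Fin.tail s)]
      omega
    -- More than 2^p·K^(2(d+1)) words remain for at most K² pairs of letters.
    obtain ⟨⟨a₀, b₀⟩, hab₀, hT₀⟩ : ∃ ab ∈ O, 2 ^ p * K ^ (2 * d) < (T ab).card := by
      by_contra! hcon
      have h1 := Finset.sum_le_card_nsmul O _ _ hcon
      have h2 : O.card ≤ K ^ 2 := by
        refine (Finset.card_le_univ O).trans ?_
        rw [Fintype.card_prod, sq]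
      have h3 : O.card • (2 ^ p * K ^ (2 * d)) ≤ K ^ 2 * (2 ^ p * K ^ (2 * d)) := by
        rw [smul_eq_mul]
        gcongr
      have h4 : K ^ 2 * (2 ^ p * K ^ (2 * d)) = 2 ^ p * K ^ (2 * (d + 1)) := by ring
      have h5 : 2 ^ (p + 1) * K ^ (2 * (d + 1))
          = 2 ^ p * K ^ (2 * (d + 1)) + 2 ^ p * K ^ (2 * (d + 1)) := by ring
      omega
    obtain ⟨i, a, b, hab, hz⟩ := ih d (T (a₀, b₀)) hT₀
    refine ⟨Fin.cons 0 fun k => (i k).succ, Fin.cons a₀ a, Fin.cons b₀ b, fun k => ?_,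
      fun z => ?_⟩
    · refine Fin.cases ?_ (fun k => ?_) k
      · simpa [hO] using hab₀
      · simpa using hab k
    · obtain ⟨x, hx, hk⟩ := hz (Fin.tail z)
      obtain ⟨ha, hb⟩ := (Finset.mem_filter.mp hx).2
      refine ⟨Fin.cons (if z 0 then b₀ else a₀) x, ?_, fun k => ?_⟩
      · split_ifs
        exacts [hb, ha]
      · refine Fin.cases ?_ (fun k => ?_) k
        · simp
        · exact hk k

/-! ### Lower bounds for Equals-Index -/

/-- 13 is the least exponent e with 8 ≤ (32/27)^e. -/
theorem le_of_pow_le_eight_pow {a b : ℕ} (h : (32 / 27 : ℝ) ^ a ≤ 8 ^ b) : a ≤ 13 * b := by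
  have h8 : (8 : ℝ) ^ b ≤ (32 / 27) ^ (13 * b) := by
    rw [pow_mul]
    gcongr
    norm_num
  exact (pow_le_pow_iff_right₀ (by norm_num)).mp (h.trans h8)

/-- An online Merlin-Arthur protocol for `eq-idx` with short help strings needs long messages. -/
theorem OMAProtocol.eqIdx_vcost_lower_bound {p q : ℕ} (hp : 0 < p)
    (P : OMAProtocol (Fin p → Fin q → Bool) ((Fin q → Bool) × Fin p))
    (hP : P.Solves (eqIdx p q)) (hh : 2 * (P.hcost + 2) ≤ q) :
    p / 8 ≤ 13 * (P.vcost + 1) := by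
  classical
  set h := P.hcost with hdef
  set d := p / 8 with hd
  have hhelp : ∀ x y, (P.help x y).length ≤ h := fun x y =>
    Finset.le_sup (f := fun a : (Fin p → Fin q → Bool) × ((Fin q → Bool) × Fin p) =>
      (P.help a.1 a.2).length) (Finset.mem_univ (x, y))
  have hmsg : ∀ x ω, (P.msg x ω).length ≤ P.vcost := fun x ω =>
    Finset.le_sup (f := fun a : (Fin p → Fin q → Bool) × (Fin P.coins → Bool) =>
      (P.msg a.1 a.2).length) (Finset.mem_univ (x, ω))
  have hA : Fintype.card (Fin q → Bool) = 2 ^ q := by simp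
  set helps : Finset (Fin p → List Bool) := Fintype.piFinset fun _ => shortStrings h
  -- Merlin's honest help on the yes-instances y = x_j.
  set H : (Fin p → Fin q → Bool) → Fin p → List Bool := fun x j => P.help x (x j, j) with hH
  have hmaps : ∀ x ∈ (Finset.univ : Finset (Fin p → Fin q → Bool)), H x ∈ helps := fun x _ =>
    Fintype.mem_piFinset.mpr fun j => mem_shortStrings (hhelp _ _)
  have hcount : helps.card * (2 ^ p * Fintype.card (Fin q → Bool) ^ (2 * d))
      < (Finset.univ : Finset (Fin p → Fin q → Bool)).card := by
    have h1 : helps.card ≤ 2 ^ ((h + 1) * p) := by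
      simp only [helps, Fintype.card_piFinset, Finset.prod_const, Finset.card_univ,
        Fintype.card_fin]
      rw [pow_mul]
      exact Nat.pow_le_pow_left (card_shortStrings_le h) p
    have h2 : (Finset.univ : Finset (Fin p → Fin q → Bool)).card = 2 ^ (q * p) := by
      rw [Finset.card_univ, Fintype.card_pi, Finset.prod_const, hA, Finset.card_univ,
        Fintype.card_fin, pow_mul]
    rw [h2, hA, ← pow_mul]
    refine (Nat.mul_le_mul_right _ h1).trans_lt ?_
    rw [← pow_add, ← pow_add]
    refine Nat.pow_lt_pow_right one_lt_two ?_
    -- The exponents add up to (h+2)p + 2qd ≤ qp/2 + qp/4 < qp.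
    have h3 : 8 * d ≤ p := Nat.mul_div_le p 8
    have hq : 0 < q := by omega
    have h4 : 2 * (h + 2) * p ≤ q * p := Nat.mul_le_mul_right p hh
    have h5 : q * (8 * d) ≤ q * p := Nat.mul_le_mul_left q h3
    have h6 : 0 < q * p := Nat.mul_pos hq hp
    nlinarith
  obtain ⟨η, -, hη⟩ := Finset.exists_lt_card_fiber_of_mul_lt_card_of_maps_to hmaps hcount
  obtain ⟨i, a, b, hab, hz⟩ := exists_shattered d _ hη
  choose x hx hxk using hz
  have hxη : ∀ z, H (x z) = η := fun z => (Finset.mem_filter.mp (hx z)).2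
  -- Bit k is guessed by running Bob on the word b_k with help η. This help is honest when the block
  -- is b_k, and soundness covers any help when it is a_k.
  refine le_of_pow_le_eight_pow <| index_lower_bound (fun z ω => P.msg (x z) ω)
    (fun m ω k => decide (P.out (b k, i k) (η (i k)) m ω = some true))
    (fun z ω => hmsg _ _) fun z k => ?_
  cases hzk : z k with
  | true =>
    have hx1 : x z (i k) = b k := by simpa [hzk] using hxk z k
    have := hP.1 (x z) (b k, i k) (by simp [eqIdx, hx1])
    rw [← hx1, show P.help (x z) (x z (i k), i k) = η (i k) from congrFun (hxη z) (i k),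
      hx1] at this
    simpa using this
  | false =>
    have hx1 : x z (i k) = a k := by simpa [hzk] using hxk z k
    have := hP.2 (x z) (b k, i k) (by simp [eqIdx, hx1, (hab k).symm]) (η (i k))
    simpa using this

/-! ### One-way protocols as online Merlin-Arthur protocols -/

/-- A one-way protocol, viewed as an online Merlin-Arthur protocol with empty help string. -/
def OneWayProtocol.toOMA {X Y : Type} (P : OneWayProtocol X Y) : OMAProtocol X Y where
  coins := P.coins
  help _ _ := []
  msg := P.msg
  out y _ m _ := some (P.out y m)

theorem OneWayProtocol.Solves.toOMA {X Y : Type} {P : OneWayProtocol X Y} {f : X → Y → Bool}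
    (hP : P.Solves f) : P.toOMA.Solves f := by
  refine ⟨fun x y hf => ?_, fun x y hf _ => ?_⟩
  · simpa [OneWayProtocol.toOMA, hf] using hP x y
  · simpa [OneWayProtocol.toOMA, hf] using hP x y

theorem OneWayProtocol.hcost_toOMA {X Y : Type} [Fintype X] [Fintype Y]
    (P : OneWayProtocol X Y) : P.toOMA.hcost = 0 := by
  simp [OMAProtocol.hcost, OneWayProtocol.toOMA]

theorem OneWayProtocol.vcost_toOMA {X Y : Type} [Fintype X]
    (P : OneWayProtocol X Y) : P.toOMA.vcost = P.cost := rfl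

/-- An optimal one-way protocol, provided that there is one at all. -/
theorem exists_oneWayProtocol_cost_eq {X Y : Type} [Fintype X] {f : X → Y → Bool}
    (h : ∃ P : OneWayProtocol X Y, P.Solves f) :
    ∃ P : OneWayProtocol X Y, P.Solves f ∧ P.cost = oneWayComplexity f :=
  Nat.sInf_mem (s := {c | ∃ P : OneWayProtocol X Y, P.Solves f ∧ P.cost = c})
    (h.imp' (fun P => P.cost) fun P hP => ⟨P, hP, rfl⟩)

/-- The existence hypothesis excludes the default value `sInf ∅ = 0` on the right. -/
theorem omaComplexity_le_oneWayComplexity {X Y : Type} [Fintype X] [Fintype Y]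
    {f : X → Y → Bool} (h : ∃ P : OneWayProtocol X Y, P.Solves f) :
    omaComplexity f ≤ oneWayComplexity f := by
  obtain ⟨P, hP, hc⟩ := exists_oneWayProtocol_cost_eq h
  refine Nat.sInf_le ⟨P.toOMA, hP.toOMA, ?_⟩
  rw [OMAProtocol.tcost, P.hcost_toOMA, P.vcost_toOMA, hc, zero_add]

/-- The one-way complexity of `eq-idx` is at least linear in the number of blocks. -/
theorem eqIdx_oneWayComplexity_lower_bound {p q : ℕ} (hp : 0 < p) (hq : 4 ≤ q)
    (h : ∃ P : OneWayProtocol (Fin p → Fin q → Bool) ((Fin q → Bool) × Fin p),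
      P.Solves (eqIdx p q)) :
    p / 8 ≤ 13 * (oneWayComplexity (eqIdx p q) + 1) := by
  obtain ⟨P, hP, hc⟩ := exists_oneWayProtocol_cost_eq h
  have := P.toOMA.eqIdx_vcost_lower_bound hp hP.toOMA (by rw [P.hcost_toOMA]; omega)
  rwa [P.vcost_toOMA, hc] at this

/-! ### Protocols with structured coins and messages -/

theorem coinProb_le_third {r : ℕ} {Ω : Type*} [Fintype Ω] (e : (Fin r → Bool) ≃ Ω) (E : Ω → Prop)
    [DecidablePred E] (h : 3 * (Finset.univ.filter E).card ≤ 2 ^ r) :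
    coinProb r (fun ω => E (e ω)) ≤ 1 / 3 := by
  have hcard : (Finset.univ.filter fun ω => E (e ω)).card = (Finset.univ.filter E).card := by
    rw [← Fintype.card_subtype, ← Fintype.card_subtype]
    exact Fintype.card_congr (e.subtypeEquiv fun _ => Iff.rfl)
  rw [coinProb_eq_card, hcard, div_le_div_iff₀ (by positivity) (by norm_num)]
  have : (3 : ℝ) * (Finset.univ.filter E).card ≤ 2 ^ r := by exact_mod_cast h
  linarith

/-- A one-way protocol whose coins are a uniform element of `Ω` and whose messages are elements
of `M`. -/
theorem exists_oneWayProtocol {X Y Ω M : Type} [Fintype X] [Fintype Ω] [Fintype M] [Nonempty M]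
    {f : X → Y → Bool} {r k : ℕ} (hΩ : Fintype.card Ω = 2 ^ r) (hM : Fintype.card M ≤ 2 ^ k)
    (msg : X → Ω → M) (out : Y → M → Bool)
    (herr : ∀ x y, 3 * (Finset.univ.filter fun ω => out y (msg x ω) ≠ f x y).card ≤ 2 ^ r) :
    ∃ P : OneWayProtocol X Y, P.Solves f ∧ P.cost ≤ k := by
  obtain ⟨enc, dec, hdec, hlen⟩ := exists_fixedLength_code hM
  have e : (Fin r → Bool) ≃ Ω := Fintype.equivOfCardEq (by simp [hΩ])
  refine ⟨⟨r, fun x ω => enc (msg x (e ω)), fun y m => out y (dec m)⟩, fun x y => ?_, ?_⟩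
  · simp only [hdec]
    exact coinProb_le_third e (fun ω => out y (msg x ω) ≠ f x y) (herr x y)
  · exact Finset.sup_le fun a _ => (hlen _).le

/-- An online Merlin-Arthur protocol whose coins are a uniform element of `Ω`, whose help strings
are elements of `H` and whose messages are elements of `M`. -/
theorem exists_omaProtocol {X Y Ω H M : Type} [Fintype X] [Fintype Ω] [Fintype H] [Nonempty H]
    [Fintype M] [Nonempty M] {f : X → Y → Bool} {r k : ℕ}
    (hΩ : Fintype.card Ω = 2 ^ r) (hM : Fintype.card M ≤ 2 ^ k) (help : X → Y → H)
    (msg : X → Ω → M) (out : Y → H → M → Ω → Bool)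
    (hone : ∀ x y ω, f x y = true → out y (help x y) (msg x ω) ω = true)
    (hzero : ∀ x y h, f x y = false →
      3 * (Finset.univ.filter fun ω => out y h (msg x ω) ω = true).card ≤ 2 ^ r) :
    ∃ P : OMAProtocol X Y, P.Solves f ∧ P.vcost ≤ k := by
  obtain ⟨enc, dec, hdec, hlen⟩ := exists_fixedLength_code hM
  -- Help length is irrelevant here, so the wasteful |H| bits suffice.
  obtain ⟨encH, decH, hdecH, -⟩ :=
    exists_fixedLength_code (A := H) (k := Fintype.card H) Nat.lt_two_pow_self.le
  have e : (Fin r → Bool) ≃ Ω := Fintype.equivOfCardEq (by simp [hΩ])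
  refine ⟨⟨r, fun x y => encH (help x y), fun x ω => enc (msg x (e ω)),
    fun y h m ω => some (out y (decH h) (dec m) (e ω))⟩, ⟨fun x y hf => ?_, fun x y hf h => ?_⟩, ?_⟩
  · simp only [hdec, hdecH, hone x y _ hf]
    simp [coinProb]
  · simp only [hdec, Option.some.injEq]
    exact coinProb_le_third e (fun ω => out y (decH h) (msg x ω) ω = true) (hzero x y _ hf)
  · exact Finset.sup_le fun a _ => (hlen _).le

/-! ### Hashing -/

/-- Two different vectors have the same inner product with a random vector with probability
`1 / |K|`. -/
theorem card_filter_dotProduct_eq {K I : Type*} [Field K] [Fintype K] [DecidableEq K] [Fintype I]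
    [DecidableEq I] {u w : I → K} (h : u ≠ w) :
    (Finset.univ.filter fun β : I → K => β ⬝ᵥ u = β ⬝ᵥ w).card * Fintype.card K
      = Fintype.card (I → K) := by
  -- The colliding vectors are the kernel of a functional onto K.
  let φ : (I → K) →ₗ[K] K := (dotProductBilin K K).flip (u - w)
  have hφ : ∀ β, φ β = β ⬝ᵥ (u - w) := fun β => rfl
  have hsurj : Function.Surjective φ := by
    obtain ⟨i, hi⟩ := Function.ne_iff.mp h
    intro c
    refine ⟨Pi.single i (c / (u i - w i)), ?_⟩
    rw [hφ, single_dotProduct, Pi.sub_apply, div_mul_cancel₀ _ (sub_ne_zero.mpr hi)]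
  have h1 := Submodule.card_eq_card_quotient_mul_card (LinearMap.ker φ)
  rw [Nat.card_congr (φ.quotKerEquivOfSurjective hsurj).toEquiv] at h1
  rw [← Fintype.card_subtype, ← Nat.card_eq_fintype_card, ← Nat.card_eq_fintype_card,
    ← Nat.card_eq_fintype_card, h1]
  congr 1
  refine Nat.card_congr (Equiv.subtypeEquivRight fun β => ?_)
  rw [LinearMap.mem_ker, hφ, dotProduct_sub, sub_eq_zero]

/-- The word `x` as a polynomial over `F`, evaluated at `α`. -/
def reedSolomon {F : Type*} [Field F] {q : ℕ} (x : Fin q → Bool) (α : F) : F :=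
  ∑ i, (if x i then 1 else 0) * α ^ (i : ℕ)

/-- The encodings of two different words agree in fewer positions than the length of the words. -/
theorem card_filter_reedSolomon_eq_le {F : Type*} [Field F] [Fintype F] [DecidableEq F] {q : ℕ}
    {x y : Fin q → Bool} (h : x ≠ y) :
    (Finset.univ.filter fun α : F => reedSolomon x α = reedSolomon y α).card ≤ q := by
  classical
  set c : Fin q → F := fun i => (if x i then 1 else 0) - (if y i then 1 else 0) with hc
  set P : Polynomial F := ∑ i : Fin q, Polynomial.C (c i) * Polynomial.X ^ (i : ℕ) with hP
  have hcoeff : ∀ i : Fin q, P.coeff i = c i := fun i => by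
    simp [hP, Polynomial.coeff_C_mul, Polynomial.coeff_X_pow,
      Fin.val_inj]
  have hne : P ≠ 0 := fun h0 => by
    obtain ⟨i, hi⟩ := Function.ne_iff.mp h
    have := hcoeff i
    rw [h0] at this
    cases hx : x i <;> cases hy : y i <;> simp [hc, hx, hy] at this hi
  have hdeg : P.natDegree ≤ q :=
    Polynomial.natDegree_sum_le_of_forall_le _ _ fun i _ =>
      (Polynomial.natDegree_C_mul_X_pow_le _ _).trans i.2.le
  refine le_trans ?_ (P.card_roots'.trans hdeg)
  refine le_trans (Finset.card_le_card fun α hα => ?_) (Multiset.toFinset_card_le P.roots)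
  rw [Multiset.mem_toFinset, Polynomial.mem_roots hne, Polynomial.IsRoot, hP,
    Polynomial.eval_finsetSum]
  simp only [Polynomial.eval_mul, Polynomial.eval_C, Polynomial.eval_pow, Polynomial.eval_X, hc,
    sub_mul, Finset.sum_sub_distrib]
  exact sub_eq_zero.mpr (Finset.mem_filter.mp hα).2

noncomputable instance : Fintype (GaloisField 2 2) := Fintype.ofFinite _

/-! ### Upper bounds for Equals-Index -/

/-- The private-coin one-way protocol that sends a random fingerprint of each block, obtained by
hashing a random position of its Reed-Solomon encoding. -/
theorem exists_oneWayProtocol_eqIdx {p q m : ℕ} (hm : m ≠ 0) (hq : 12 * q ≤ 4 ^ m) :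
    ∃ P : OneWayProtocol (Fin p → Fin q → Bool) ((Fin q → Bool) × Fin p),
      P.Solves (eqIdx p q) ∧ P.cost ≤ 4 * m + 2 * p := by
  classical
  let K := GaloisField 2 2
  let F := GaloisField 2 (2 * m)
  have : Fintype F := Fintype.ofFinite _
  have hK : Fintype.card K = 4 := by
    rw [← Nat.card_eq_fintype_card, GaloisField.card 2 2 two_ne_zero]; norm_num
  have hF : Fintype.card F = 4 ^ m := by
    rw [← Nat.card_eq_fintype_card, GaloisField.card 2 (2 * m) (by omega), pow_mul]; norm_num
  have hV : Fintype.card (Fin m → K) = 4 ^ m := by simp [hK]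
  have e : F ≃ (Fin m → K) := Fintype.equivOfCardEq (by rw [hF, hV])
  have h16 : (2 : ℕ) ^ (4 * m) = 4 ^ m * 4 ^ m := by
    rw [pow_mul, ← mul_pow]; norm_num
  have hΩ : Fintype.card (F × (Fin m → K)) = 2 ^ (4 * m) := by
    rw [Fintype.card_prod, hF, hV, h16]
  -- The coins are private, so Alice sends them too: 4m bits, plus 2 bits per block. The map `e` is
  -- only a bijection; injectivity is all that is used.
  let hash : (Fin q → Bool) → F × (Fin m → K) → K := fun x ω => ω.2 ⬝ᵥ e (reedSolomon x ω.1)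
  have hcoll : ∀ x y : Fin q → Bool, y ≠ x →
      3 * (Finset.univ.filter fun ω => hash y ω = hash x ω).card ≤ 2 ^ (4 * m) := by
    intro x y hxy
    set B : Finset F := Finset.univ.filter fun α => reedSolomon y α = reedSolomon x α with hB
    have hsub : (Finset.univ.filter fun ω => hash y ω = hash x ω).card
        = ∑ α : F, (Finset.univ.filter fun β : Fin m → K => hash y (α, β) = hash x (α, β)).card := by
      simp only [Finset.card_filter]
      exact Fintype.sum_prod_type _
    -- The collision probability is at most 1/4 + q/4^m ≤ 1/4 + 1/12 = 1/3.
    have hterm : ∀ α : F,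
        4 * (Finset.univ.filter fun β : Fin m → K => hash y (α, β) = hash x (α, β)).card
          ≤ 4 ^ m + (if α ∈ B then 4 * 4 ^ m else 0) := fun α => by
      split_ifs with hα
      · have := Finset.card_le_univ
          (Finset.univ.filter fun β : Fin m → K => hash y (α, β) = hash x (α, β))
        rw [hV] at this
        omega
      · have hne : e (reedSolomon y α) ≠ e (reedSolomon x α) := fun h =>
          hα (Finset.mem_filter.mpr ⟨Finset.mem_univ _, e.injective h⟩)
        have := card_filter_dotProduct_eq hne
        rw [hK, hV, mul_comm] at this
        exact this.le
    have hsum := Finset.sum_le_sum fun α (_ : α ∈ Finset.univ) => hterm α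
    rw [← Finset.mul_sum, ← hsub, Finset.sum_add_distrib, Finset.sum_ite_mem] at hsum
    simp only [Finset.univ_inter, Finset.sum_const, Finset.card_univ, hF, smul_eq_mul] at hsum
    have hBq : B.card ≤ q := card_filter_reedSolomon_eq_le hxy
    have h1 : B.card * (12 * 4 ^ m) ≤ 4 ^ m * 4 ^ m := by
      calc B.card * (12 * 4 ^ m) ≤ q * (12 * 4 ^ m) := Nat.mul_le_mul_right _ hBq
        _ = 12 * q * 4 ^ m := by ring
        _ ≤ _ := Nat.mul_le_mul_right _ hq
    rw [h16]
    nlinarith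
  refine exists_oneWayProtocol (Ω := F × (Fin m → K)) (M := (F × (Fin m → K)) × (Fin p → K))
    hΩ ?_ (fun x ω => (ω, fun j => hash (x j) ω))
    (fun y M => decide (hash y.1 M.1 = M.2 y.2)) fun x y => ?_
  · rw [Fintype.card_prod, hΩ, Fintype.card_fun, hK, Fintype.card_fin, pow_add, pow_mul 2 2 p]
    norm_num
  · by_cases hy : y.1 = x y.2
    · simp [eqIdx, hy]
    · simpa [eqIdx, hy] using hcoll (x y.2) y.1 hy

/-- The online Merlin-Arthur protocol in which Merlin sends Alice's input and Alice sends two bits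
for its verification. -/
theorem exists_omaProtocol_eqIdx (p q : ℕ) :
    ∃ P : OMAProtocol (Fin p → Fin q → Bool) ((Fin q → Bool) × Fin p),
      P.Solves (eqIdx p q) ∧ P.vcost ≤ 2 := by
  classical
  -- Over four elements a false claim about x survives with probability 1/4 ≤ 1/3; two elements
  -- would give 1/2.
  let K := GaloisField 2 2
  have hK : Fintype.card K = 4 := by
    rw [← Nat.card_eq_fintype_card, GaloisField.card 2 2 two_ne_zero]; norm_num
  have hΩ : Fintype.card (Fin p × Fin q → K) = 2 ^ (2 * (p * q)) := by
    rw [Fintype.card_fun, hK, pow_mul]; simp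
  let v : (Fin p → Fin q → Bool) → Fin p × Fin q → K := fun x i => if x i.1 i.2 then 1 else 0
  have hv : Function.Injective v := fun x y h => by
    funext i j
    have := congrFun h (i, j)
    simp only [v] at this
    cases hx : x i j <;> cases hy : y i j <;> simp_all
  refine exists_omaProtocol (Ω := Fin p × Fin q → K) (H := Fin p → Fin q → Bool) (M := K) hΩ
    (by rw [hK]; norm_num) (fun x _ => x) (fun x β => β ⬝ᵥ v x)
    (fun y h m β => decide (y.1 = h y.2 ∧ β ⬝ᵥ v h = m)) (fun x y ω hf => ?_) fun x y h hf => ?_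
  · simpa [eqIdx] using hf
  · have hy : y.1 ≠ x y.2 := by simpa [eqIdx] using hf
    by_cases hx : h = x
    · simp [hx, hy]
    · have hcoll := card_filter_dotProduct_eq (hv.ne hx)
      rw [hK, hΩ] at hcoll
      have hle : (Finset.univ.filter fun β : Fin p × Fin q → K =>
          decide (y.1 = h y.2 ∧ β ⬝ᵥ v h = β ⬝ᵥ v x) = true).card
          ≤ (Finset.univ.filter fun β : Fin p × Fin q → K => β ⬝ᵥ v h = β ⬝ᵥ v x).card :=
        Finset.card_le_card fun β hβ => by
          simp only [Finset.mem_filter, decide_eq_true_eq] at hβ ⊢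
          exact ⟨hβ.1, hβ.2.2⟩
      omega

/-! ### The case of logarithmically many blocks -/

theorem exists_oneWayProtocol_eqIdxLog (n : ℕ) :
    ∃ P : OneWayProtocol (Fin (Nat.log 2 n) → Fin (n / Nat.log 2 n) → Bool)
        ((Fin (n / Nat.log 2 n) → Bool) × Fin (Nat.log 2 n)),
      P.Solves (eqIdxLog n) ∧ P.cost ≤ 6 * Nat.log 2 n + 12 := by
  set p := Nat.log 2 n with hp
  have hq : 12 * (n / p) ≤ 4 ^ (p + 3) := by
    have h1 : n / p ≤ n := Nat.div_le_self n p
    have h2 : n < 2 ^ (p + 1) := Nat.lt_pow_succ_log_self one_lt_two n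
    have h3 : (2 : ℕ) ^ p ≤ 4 ^ p := Nat.pow_le_pow_left (by norm_num) p
    rw [pow_succ] at h2
    rw [pow_add]
    omega
  -- The 3 in m = p + 3 gives 12·2^(p+1) ≤ 4^(p+3).
  obtain ⟨P, hP, hc⟩ := exists_oneWayProtocol_eqIdx (p := p) (m := p + 3) (by omega) hq
  exact ⟨P, hP, by omega⟩

theorem oneWayComplexity_eqIdxLog_le (n : ℕ) :
    oneWayComplexity (eqIdxLog n) ≤ 6 * Nat.log 2 n + 12 := by
  obtain ⟨P, hP, hc⟩ := exists_oneWayProtocol_eqIdxLog n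
  refine le_trans ?_ hc
  exact Nat.sInf_le ⟨P, hP, rfl⟩

theorem tendsto_log_two_atTop : Tendsto (Nat.log 2) atTop atTop :=
  tendsto_atTop.mpr fun b => (eventually_ge_atTop (2 ^ b)).mono fun _ hn =>
    Nat.le_log_of_pow_le one_lt_two hn

/-- Holds because e^(1/4) < 2. Its form matches 2^p ≤ n < p(2t+5), from which e^(p/4) ≤ t is to be
read off. -/
theorem eventually_le_two_pow :
    ∀ᶠ p : ℕ in atTop, (p : ℝ) * (2 * Real.exp (p / 4) + 5) ≤ 2 ^ p := by
  have hr : |Real.exp (1 / 4) / 2| < 1 := by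
    rw [abs_of_pos (by positivity), div_lt_one two_pos, ← Real.lt_log_iff_exp_lt two_pos]
    linarith [Real.log_two_gt_d9]
  have h := tendsto_pow_const_mul_const_pow_of_abs_lt_one 1 hr
  filter_upwards [h.eventually_le_const (show (0 : ℝ) < 1 / 7 by norm_num)] with p hp
  rw [div_pow, ← Real.exp_nat_mul, pow_one, ← mul_div_assoc, div_le_iff₀ (by positivity),
    show (p : ℝ) * (1 / 4) = p / 4 by ring] at hp
  have h1 : 1 ≤ Real.exp (p / 4) := Real.one_le_exp (by positivity)
  have h2 : (p : ℝ) * 1 ≤ p * Real.exp (p / 4) := by gcongr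
  linarith

/-- 4 is the block length that the lower bound requires for empty help. -/
theorem eventually_four_le_div_log : ∀ᶠ n : ℕ in atTop, 4 ≤ n / Nat.log 2 n := by
  filter_upwards [tendsto_log_two_atTop.eventually eventually_le_two_pow,
    tendsto_log_two_atTop.eventually_ge_atTop 1, eventually_ne_atTop 0] with n hn h1 h0
  rw [Nat.le_div_iff_mul_le (by omega)]
  have h2 : 2 ^ Nat.log 2 n ≤ n := Nat.pow_log_le_self 2 h0
  have h3 : ((Nat.log 2 n : ℕ) : ℝ) * 4 ≤ 2 ^ Nat.log 2 n := by
    refine le_trans ?_ hn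
    gcongr
    linarith [Real.exp_pos ((Nat.log 2 n : ℝ) / 4)]
  have h4 : Nat.log 2 n * 4 ≤ 2 ^ Nat.log 2 n := by exact_mod_cast h3
  omega

theorem tendsto_oneWayComplexity_eqIdxLog :
    Tendsto (fun n => oneWayComplexity (eqIdxLog n)) atTop atTop := by
  refine tendsto_atTop.mpr fun b => ?_
  filter_upwards [tendsto_log_two_atTop.eventually_ge_atTop (8 * (13 * (b + 1))),
    eventually_four_le_div_log] with n hn hq
  have := eqIdx_oneWayComplexity_lower_bound (by omega) hq
    ((exists_oneWayProtocol_eqIdxLog n).imp fun _ h => h.1)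
  change _ ≤ 13 * (oneWayComplexity (eqIdxLog n) + 1) at this
  omega

theorem nontrivialOMACosts_eqIdxLog_nonempty : (nontrivialOMACosts eqIdxLog).Nonempty := by
  have h : ∀ n, ∃ P : OMAProtocol (Fin (Nat.log 2 n) → Fin (n / Nat.log 2 n) → Bool)
      ((Fin (n / Nat.log 2 n) → Bool) × Fin (Nat.log 2 n)),
      P.Solves (eqIdxLog n) ∧ P.vcost ≤ 2 := fun n => exists_omaProtocol_eqIdx _ _
  choose P hP hv using h
  refine ⟨fun n => (P n).tcost, P, ⟨hP, ?_⟩, fun _ => rfl⟩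
  have hbig : (fun _ => (2 : ℝ)) =o[atTop] fun n => (oneWayComplexity (eqIdxLog n) : ℝ) :=
    isLittleO_const_left.mpr <| Or.inr <| tendsto_norm_atTop_atTop.comp <|
      tendsto_natCast_atTop_atTop.comp tendsto_oneWayComplexity_eqIdxLog
  refine IsBigO.trans_isLittleO (IsBigO.of_bound 1 (Eventually.of_forall fun n => ?_)) hbig
  rw [one_mul, Real.norm_natCast, Real.norm_two]
  exact_mod_cast hv n

theorem exp_oneWayComplexity_le_nontrivialOMACosts {t : ℕ → ℕ}
    (ht : t ∈ nontrivialOMACosts eqIdxLog) :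
    ∀ᶠ n in atTop, Real.exp (1 / 72 * (oneWayComplexity (eqIdxLog n) : ℝ)) ≤ (t n : ℝ) := by
  obtain ⟨P, ⟨hP, ho⟩, hcost⟩ := ht
  -- 3744 = 13·18·16: as R ≤ 18p, this makes 13·vcost at most p/16, half of p/8; p ≥ 300 absorbs the
  -- additive terms.
  filter_upwards [ho.bound (show (0 : ℝ) < 1 / 3744 by norm_num),
    tendsto_log_two_atTop.eventually eventually_le_two_pow,
    tendsto_log_two_atTop.eventually_ge_atTop 300, eventually_ne_atTop 0] with n hv hexp hp h0
  rw [Real.norm_natCast, Real.norm_natCast] at hv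
  have hR := oneWayComplexity_eqIdxLog_le n
  have hv' : 3744 * (P n).vcost ≤ oneWayComplexity (eqIdxLog n) := by
    have : (3744 : ℝ) * (P n).vcost ≤ oneWayComplexity (eqIdxLog n) := by linarith
    exact_mod_cast this
  have hh : n / Nat.log 2 n < 2 * ((P n).hcost + 2) := by
    by_contra! hcon
    have := (P n).eqIdx_vcost_lower_bound (by omega) (hP n) hcon
    omega
  have hle : (P n).hcost ≤ t n := by
    rw [hcost n]
    exact Nat.le_add_right _ _
  set p := Nat.log 2 n with hpdef
  have hn : 2 ^ p ≤ n := Nat.pow_log_le_self 2 h0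
  have hlt : n < p * (2 * t n + 5) := by
    have h1 : n < p * (n / p + 1) := Nat.lt_mul_div_succ n (by omega)
    have h2 : n / p < 2 * (t n + 2) := hh.trans_le (by omega)
    exact h1.trans_le (Nat.mul_le_mul_left p (by omega))
  have hlt' : (2 : ℝ) ^ p ≤ p * (2 * t n + 5) := by exact_mod_cast hn.trans hlt.le
  have hpos : (0 : ℝ) < p := by exact_mod_cast (by omega : 0 < p)
  have hfin := le_of_mul_le_mul_left (hexp.trans hlt') hpos
  have hR18 : (oneWayComplexity (eqIdxLog n) : ℝ) ≤ 18 * p := by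
    exact_mod_cast hR.trans (by omega)
  -- 72 = 18·4 turns R ≤ 18p into the exponent p/4.
  calc Real.exp (1 / 72 * (oneWayComplexity (eqIdxLog n) : ℝ)) ≤ Real.exp (p / 4) :=
        Real.exp_le_exp.mpr (by linarith)
    _ ≤ t n := by linarith

theorem corollary2 :
    NontrivialOMAIsExpOmega eqIdxLog (fun n => omaComplexity (eqIdxLog n)) ∧
      NontrivialOMAIsExpOmega eqIdxLog (fun n => oneWayComplexity (eqIdxLog n)) := by
  refine ⟨⟨nontrivialOMACosts_eqIdxLog_nonempty, 1 / 72, by norm_num, fun t ht => ?_⟩,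
    ⟨nontrivialOMACosts_eqIdxLog_nonempty, 1 / 72, by norm_num, fun t ht =>
      exp_oneWayComplexity_le_nontrivialOMACosts ht⟩⟩
  filter_upwards [exp_oneWayComplexity_le_nontrivialOMACosts ht] with n hn
  refine le_trans (Real.exp_le_exp.mpr ?_) hn
  have : (omaComplexity (eqIdxLog n) : ℝ) ≤ oneWayComplexity (eqIdxLog n) := by
    exact_mod_cast omaComplexity_le_oneWayComplexity
      ((exists_oneWayProtocol_eqIdxLog n).imp fun _ h => h.1)
  linarith
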